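/- Let $d\ge 0$, let $S^d$ be the space of symmetric real $d\times d$ matrices, $S^d_+$ the cone of positive semidefinite ones, $\|\cdot\|$ the spectral norm and $\|\cdot\|_F$ the Frobenius norm. For $\chi=0,1$ let the following be given: a convex compact set $\mathcal U_\chi$ contained in the interior of $S^d_+$; a matrix $\Theta_*^{(\chi)}\in S^d_+$ with $\Theta_*^{(\chi)}\succeq\Theta$ for all $\Theta\in\mathcal U_\chi$; a number $\delta_\chi\in[0,2]$ with $\|\Theta^{1/2}(\Theta_*^{(\chi)})^{-1/2}-I_d\|\le\delta_\chi$ for all $\Theta\in\mathcal U_\chi$; a number $\beta_\chi\in[0,1)$; and a nonempty convex compact set $\mathcal Z_\chi\subset\{Z\in S^{d+1}_+: Z_{d+1,d+1}=1\}$. Put $\phi_{\mathcal Z_\chi}(Y)=\max_{Z\in\mathcal Z_\chi}\mathrm{Tr}(ZY)$, $$\mathcal H_\chi=\{(h,H)\in\mathbb R^d\times S^d:\ -\beta_\chi(\Theta_*^{(\chi)})^{-1}\preceq H\preceq\beta_\chi(\Theta_*^{(\chi)})^{-1}\},$$ and, for $(h,H)\in\mathcal H_\chi$ and $\Theta\in\mathcal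 U_\chi$, writing $\Theta_*=\Theta_*^{(\chi)}$, $\delta=\delta_\chi$ and $S=\Theta_*^{1/2}H\Theta_*^{1/2}$, $$\Phi_{\mathcal Z_\chi}(h,H;\Theta)=-\tfrac12\log\det(I-S)+\tfrac12\mathrm{Tr}([\Theta-\Theta_*]H)+\frac{\delta(2+\delta)}{2(1-\|S\|)}\|S\|_F^2+\tfrac12\phi_{\mathcal Z_\chi}\!\left(\begin{bmatrix}H&h\\h^T&0\end{bmatrix}+[H,h]^T[\Theta_*^{-1}-H]^{-1}[H,h]\right).$$ Let $\mathcal G_\chi=\{N(u,\Theta):\ \Theta\in\mathcal U_\chi,\ u\in\mathbb R^d,\ [u;1][u;1]^T\in\mathcal Z_\chi\}$. Let $$\mathcal{SV}=\min_{(h,H)\in\mathcal H_0\cap\mathcal H_1}\ \max_{\Theta_0\in\mathcal U_0,\,\Theta_1\in\mathcal U_1}\tfrac12\left[\Phi_{\mathcal Z_0}(-h,-H;\Theta_0)+\Phi_{\mathcal Z_1}(h,H;\Theta_1)\right],$$ let $(h_*,H_*;\Theta_0^*,\Theta_1^*)$ be a saddle point of this problem, and set $$\phi^*(\xi)=\tfrac12\xi^TH_*\xi+h_*^T\xi+\tfrac12\left[\Phi_{\mathcal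 Z_0}(-h_*,-H_*;\Theta_0^*)-\Phi_{\mathcal Z_1}(h_*,H_*;\Theta_1^*)\right],\qquad \epsilon^*=\exp(\mathcal{SV}).$$ For $b\in\mathbb R$ and observations $\xi_1,\xi_2,\dots$ in $\mathbb R^d$ let $$T_2=\inf\Big\{t>0:\ \max_{1\le k\le t}\sum_{i=k}^t(-\phi^*(\xi_i))\ge b\Big\}\qquad(\inf\emptyset=\infty).$$ Suppose $\epsilon^*<1$ and let $\gamma>0$. If $$b\ge\log\gamma+\log\frac{\epsilon^*}{1-\epsilon^*},$$ then for every $\nu_0\in\mathcal G_0$, when $\xi_1,\xi_2,\dots$ are i.i.d. with law $\nu_0$, one has $\mathbb E_\infty^{\nu_0}[T_2]\ge\gamma$. -/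

import Mathlib

open MeasureTheory ProbabilityTheory Matrix
open scoped ENNReal

noncomputable section

namespace RobustCusum

/-- The spectral norm of a real square matrix (operator norm for the Euclidean norm). -/
def specNorm {d : ℕ} (A : Matrix (Fin d) (Fin d) ℝ) : ℝ :=
  ‖Matrix.toEuclideanCLM (n := Fin d) (𝕜 := ℝ) A‖

/-- The Frobenius norm of a real square matrix. -/
def frobNorm {d : ℕ} (A : Matrix (Fin d) (Fin d) ℝ) : ℝ :=
  Real.sqrt (∑ i, ∑ j, A i j ^ 2)

open scoped MatrixOrder in
/-- The positive semidefinite square root `A ^ (1/2)` of a positive semidefinite matrix. -/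
def msqrt {d : ℕ} (A : Matrix (Fin d) (Fin d) ℝ) : Matrix (Fin d) (Fin d) ℝ :=
  CFC.sqrt A

/-- The Loewner order `A ⪯ B`. -/
def LoewnerLE {d : ℕ} (A B : Matrix (Fin d) (Fin d) ℝ) : Prop :=
  (B - A).PosSemidef

/-- The space of real matrices of size `d + 1`; the last index is `Sum.inr ()`. -/
abbrev LiftedMatrix (d : ℕ) : Type := Matrix (Fin d ⊕ Unit) (Fin d ⊕ Unit) ℝ

/-- The data that describe one uncertainty class of normal laws:
a set `U` of covariance matrices, an upper bound `Θs` of it, the numbers `δ` and `β`, and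
a set `Z` of lifted means. -/
structure UncertaintyData (d : ℕ) where
  U : Set (Matrix (Fin d) (Fin d) ℝ)
  Θs : Matrix (Fin d) (Fin d) ℝ
  δ : ℝ
  β : ℝ
  Z : Set (LiftedMatrix d)

namespace UncertaintyData

variable {d : ℕ}

/-- The standing assumptions on the data. -/
structure Admissible (D : UncertaintyData d) : Prop where
  convex_U : Convex ℝ D.U
  compact_U : IsCompact D.U
  /-- `U` lies in the interior of the cone of positive semidefinite matrices. -/
  posDef_U : ∀ Θ ∈ D.U, Θ.PosDef
  posSemidef_Θs : D.Θs.PosSemidef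
  le_Θs : ∀ Θ ∈ D.U, LoewnerLE Θ D.Θs
  δ_nonneg : 0 ≤ D.δ
  δ_le_two : D.δ ≤ 2
  norm_le_δ : ∀ Θ ∈ D.U, specNorm (msqrt Θ * (msqrt D.Θs)⁻¹ - 1) ≤ D.δ
  β_nonneg : 0 ≤ D.β
  β_lt_one : D.β < 1
  nonempty_Z : D.Z.Nonempty
  convex_Z : Convex ℝ D.Z
  compact_Z : IsCompact D.Z
  posSemidef_Z : ∀ Z ∈ D.Z, Z.PosSemidef
  corner_Z : ∀ Z ∈ D.Z, Z (Sum.inr ()) (Sum.inr ()) = 1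

/-- The support function `Y ↦ max_{Z ∈ 𝒵} Tr (Z Y)` of the set of lifted means. -/
def supportFun (D : UncertaintyData d) (Y : LiftedMatrix d) : ℝ :=
  sSup ((fun Z : LiftedMatrix d => (Z * Y).trace) '' D.Z)

/-- The set `ℋ` of pairs `(h, H)` with `H` symmetric and `-β Θs⁻¹ ⪯ H ⪯ β Θs⁻¹`. -/
def detectorSet (D : UncertaintyData d) : Set ((Fin d → ℝ) × Matrix (Fin d) (Fin d) ℝ) :=
  {p | p.2.IsSymm ∧ LoewnerLE (-(D.β • D.Θs⁻¹)) p.2 ∧ LoewnerLE p.2 (D.β • D.Θs⁻¹)}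

/-- The `d × (d + 1)` matrix `[H, h]`. -/
def appendCol (h : Fin d → ℝ) (H : Matrix (Fin d) (Fin d) ℝ) :
    Matrix (Fin d) (Fin d ⊕ Unit) ℝ :=
  Matrix.fromCols H (Matrix.replicateCol Unit h)

/-- The matrix `Θs ^ (1/2) H Θs ^ (1/2)`. -/
def scaled (D : UncertaintyData d) (H : Matrix (Fin d) (Fin d) ℝ) : Matrix (Fin d) (Fin d) ℝ :=
  msqrt D.Θs * H * msqrt D.Θs

/-- The function `Φ_𝒵 (h, H; Θ)`. -/
def Φ (D : UncertaintyData d) (h : Fin d → ℝ) (H Θ : Matrix (Fin d) (Fin d) ℝ) : ℝ :=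
  -(1 / 2) * Real.log (1 - D.scaled H).det
    + (1 / 2) * ((Θ - D.Θs) * H).trace
    + D.δ * (2 + D.δ) / (2 * (1 - specNorm (D.scaled H))) * frobNorm (D.scaled H) ^ 2
    + (1 / 2) * D.supportFun
        (Matrix.fromBlocks H (Matrix.replicateCol Unit h) (Matrix.replicateRow Unit h) 0
          + (appendCol h H)ᵀ * (D.Θs⁻¹ - H)⁻¹ * appendCol h H)

/-- The class `𝒢` of the normal laws `N(u, Θ)` with `Θ ∈ 𝒰` and `[u;1][u;1]ᵀ ∈ 𝒵`. -/
def gaussianClass (D : UncertaintyData d) : Set (Measure (EuclideanSpace ℝ (Fin d))) :=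
  {ν | ∃ (u : EuclideanSpace ℝ (Fin d)) (Θ : Matrix (Fin d) (Fin d) ℝ), Θ ∈ D.U ∧
    Matrix.vecMulVec (Sum.elim u (1 : Unit → ℝ)) (Sum.elim u (1 : Unit → ℝ)) ∈ D.Z ∧
    ν = multivariateGaussian u Θ}

end UncertaintyData

variable {d : ℕ}

/-- The objective `Φ(h, H; Θ₀, Θ₁)` of the saddle point problem. -/
def objective (D₀ D₁ : UncertaintyData d) (p : (Fin d → ℝ) × Matrix (Fin d) (Fin d) ℝ)
    (q : Matrix (Fin d) (Fin d) ℝ × Matrix (Fin d) (Fin d) ℝ) : ℝ :=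
  (1 / 2) * (D₀.Φ (-p.1) (-p.2) q.1 + D₁.Φ p.1 p.2 q.2)

/-- The value `𝒮𝒱`: the minimum over `(h, H) ∈ ℋ₀ ∩ ℋ₁` of the maximum over
`(Θ₀, Θ₁) ∈ 𝒰₀ × 𝒰₁` of the objective. -/
def saddleValue (D₀ D₁ : UncertaintyData d) : ℝ :=
  ⨅ p : ↥(D₀.detectorSet ∩ D₁.detectorSet), ⨆ q : ↥(D₀.U ×ˢ D₁.U), objective D₀ D₁ p q

/-- `ε⋆ = exp 𝒮𝒱`. -/
def epsStar (D₀ D₁ : UncertaintyData d) : ℝ :=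
  Real.exp (saddleValue D₀ D₁)

/-- `(h, H; Θ₀, Θ₁)` is a saddle point (minimum in `(h, H)`, maximum in `(Θ₀, Θ₁)`). -/
def IsSaddle (D₀ D₁ : UncertaintyData d) (h : Fin d → ℝ)
    (H Θ₀ Θ₁ : Matrix (Fin d) (Fin d) ℝ) : Prop :=
  (h, H) ∈ D₀.detectorSet ∩ D₁.detectorSet ∧ (Θ₀, Θ₁) ∈ D₀.U ×ˢ D₁.U ∧
    IsSaddlePointOn (D₀.detectorSet ∩ D₁.detectorSet) (D₀.U ×ˢ D₁.U) (objective D₀ D₁)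
      (h, H) (Θ₀, Θ₁)

/-- The quadratic detector `φ⋆` given by a saddle point `(h, H; Θ₀, Θ₁)`. -/
def detector (D₀ D₁ : UncertaintyData d) (h : Fin d → ℝ)
    (H Θ₀ Θ₁ : Matrix (Fin d) (Fin d) ℝ) (ξ : EuclideanSpace ℝ (Fin d)) : ℝ :=
  (1 / 2) * ((ξ : Fin d → ℝ) ⬝ᵥ (H *ᵥ (ξ : Fin d → ℝ))) + h ⬝ᵥ (ξ : Fin d → ℝ)
    + (1 / 2) * (D₀.Φ (-h) (-H) Θ₀ - D₁.Φ h H Θ₁)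

/-- The stopping time `inf {t > 0 : max_{1 ≤ k ≤ t} ∑_{i=k}^t (-φ(ξᵢ)) ≥ b}`, infinite if there is
no such `t`. The observations are numbered from zero: `x i` is the observation `ξ_{i+1}`. -/
def stoppingTime {E : Type*} (φ : E → ℝ) (b : ℝ) (x : ℕ → E) : ℕ∞ :=
  sInf {τ : ℕ∞ | ∃ (t : ℕ) (ht : t ≠ 0), τ = t ∧
    b ≤ (Finset.range t).sup' (Finset.nonempty_range_iff.mpr ht)
      (fun k => ∑ i ∈ Finset.Ico k t, -φ (x i))}

end RobustCusum

end

/-! The proof compares the CUSUM statistic with the Shiryaev–Roberts statistic `R`. Write `L_i = exp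
(-φ (ξ i))`. The exponential of the CUSUM maximum is one of the terms whose sum is `R_t`, so an
alarm at time `t` forces `R_t ≥ exp b`. Moreover `R_{t+1} = (1 + R_t) L_t`, with `L_t` independent
of the past. If `E L_t ≤ ε ≤ 1`, each step without an earlier alarm adds at most `ε` to the mean of
`R`. Up to time `n`, the mass stopped at height at least `exp b` is therefore paid for by `ε ∑_{t<n}
P(T > t)` (`alarm_balance`), and `n → ∞` gives `exp b ≤ ε E T`.

It remains to see that `E L ≤ ε⋆` under every law of the first class. The Gaussian integral of `exp`
of a quadratic function is explicit, and `Φ` dominates its logarithm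
(`Admissible.lintegral_exp_quadratic_le`). For the log-determinant this is a tangent-line estimate
for the concave function `log det`, with a remainder controlled by Cauchy–Schwarz. For the mean it
is antitonicity of the inverse followed by the support function of `Z`. The additive constant in the
detector turns `Φ₀` into the average of `Φ₀` and `Φ₁`, which at the saddle point is at most the
saddle value. -/

namespace RobustCusum

/-! ### False alarms of CUSUM via the Shiryaev–Roberts statistic -/

section Cusum

variable {E Ω : Type*}

/-- The Shiryaev–Roberts statistic `∑_{k < t} ∏_{k ≤ i < t} exp (-φ (x i))`. -/
noncomputable def shiryaevRoberts (φ : E → ℝ) (x : ℕ → E) (t : ℕ) : ℝ≥0∞ :=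
  ∑ k ∈ Finset.range t, ∏ i ∈ Finset.Ico k t, ENNReal.ofReal (Real.exp (-φ (x i)))

/-- No alarm has been raised up to time `t`. -/
def NoAlarm (φ : E → ℝ) (b : ℝ) (x : ℕ → E) (t : ℕ) : Prop :=
  ∀ s ≤ t, ∀ k < s, ∑ i ∈ Finset.Ico k s, -φ (x i) < b

lemma shiryaevRoberts_succ (φ : E → ℝ) (x : ℕ → E) (t : ℕ) :
    shiryaevRoberts φ x (t + 1)
      = (1 + shiryaevRoberts φ x t) * ENNReal.ofReal (Real.exp (-φ (x t))) := by
  have hk : ∀ k ∈ Finset.range t, ∏ i ∈ Finset.Ico k (t + 1), ENNReal.ofReal (Real.exp (-φ (x i)))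
      = (∏ i ∈ Finset.Ico k t, ENNReal.ofReal (Real.exp (-φ (x i))))
        * ENNReal.ofReal (Real.exp (-φ (x t))) := fun k hk =>
    Finset.prod_Ico_succ_top (Finset.mem_range.1 hk).le _
  rw [shiryaevRoberts, Finset.sum_range_succ, Finset.sum_congr rfl hk, ← Finset.sum_mul,
    shiryaevRoberts, Nat.Ico_succ_singleton, Finset.prod_singleton]
  ring

/-- A sum of nonnegative terms dominates each of them: this replaces the CUSUM maximum by a sum,
which has a linear recursion. -/
lemma ofReal_exp_le_shiryaevRoberts {φ : E → ℝ} {b : ℝ} {x : ℕ → E} {t k : ℕ} (hk : k < t)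
    (hb : b ≤ ∑ i ∈ Finset.Ico k t, -φ (x i)) :
    ENNReal.ofReal (Real.exp b) ≤ shiryaevRoberts φ x t := by
  calc ENNReal.ofReal (Real.exp b)
      ≤ ENNReal.ofReal (Real.exp (∑ i ∈ Finset.Ico k t, -φ (x i))) :=
        ENNReal.ofReal_le_ofReal (Real.exp_le_exp.2 hb)
    _ = ∏ i ∈ Finset.Ico k t, ENNReal.ofReal (Real.exp (-φ (x i))) := by
        rw [Real.exp_sum, ENNReal.ofReal_prod_of_nonneg fun _ _ => (Real.exp_pos _).le]
    _ ≤ shiryaevRoberts φ x t :=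
        Finset.single_le_sum
          (f := fun k => ∏ i ∈ Finset.Ico k t, ENNReal.ofReal (Real.exp (-φ (x i))))
          (fun _ _ => zero_le) (Finset.mem_range.2 hk)

lemma NoAlarm.mono {φ : E → ℝ} {b : ℝ} {x : ℕ → E} {s t : ℕ} (h : NoAlarm φ b x t) (hst : s ≤ t) :
    NoAlarm φ b x s :=
  fun r hr => h r (hr.trans hst)

lemma NoAlarm.lt_of_stoppingTime_eq {φ : E → ℝ} {b : ℝ} {x : ℕ → E} {t m : ℕ}
    (h : NoAlarm φ b x t) (hm : stoppingTime φ b x = m) : t < m := by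
  by_contra! hmt
  have hne : {τ : ℕ∞ | ∃ (t : ℕ) (ht : t ≠ 0), τ = t ∧
    b ≤ (Finset.range t).sup' (Finset.nonempty_range_iff.mpr ht)
      (fun k => ∑ i ∈ Finset.Ico k t, -φ (x i))}.Nonempty := by
    by_contra! hempty
    rw [stoppingTime, hempty, sInf_empty] at hm
    exact ENat.natCast_ne_top m hm.symm
  obtain ⟨s, hs, hsm, hbs⟩ := csInf_mem hne
  obtain ⟨k, hk, hkb⟩ := (Finset.le_sup'_iff _).1 hbs
  have : s = m := by
    have h1 : (m : ℕ∞) = s := hm.symm.trans hsm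
    exact_mod_cast h1.symm
  exact absurd hkb (not_le.2 (h s (this ▸ hmt) k (Finset.mem_range.1 hk)))

-- A truncated form of `T = ∑_t 1{T > t}`. Only this inequality is needed, so measurability of the
-- stopping time never enters.
open Classical in
lemma sum_indicator_noAlarm_le (φ : E → ℝ) (b : ℝ) (x : ℕ → E) (n : ℕ) :
    ∑ t ∈ Finset.range n, (if NoAlarm φ b x t then (1 : ℝ≥0∞) else 0)
      ≤ (stoppingTime φ b x : ℝ≥0∞) := by
  cases h : stoppingTime φ b x using ENat.recTopCoe with
  | top => simp
  | coe m =>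
    rw [← Finset.sum_filter, Finset.sum_const, nsmul_one, ENat.toENNReal_coe]
    norm_cast
    calc _ ≤ (Finset.range m).card := Finset.card_le_card fun t ht =>
          Finset.mem_range.2 ((Finset.mem_filter.1 ht).2.lt_of_stoppingTime_eq h)
      _ = m := Finset.card_range m

variable [MeasurableSpace E] {ξ : ℕ → Ω → E} {φ : E → ℝ} {b : ℝ}

/-- The `σ`-algebra of the first `t` observations. -/
@[reducible] def past (ξ : ℕ → Ω → E) (t : ℕ) : MeasurableSpace Ω :=
  ⨆ i ∈ Set.Iio t, MeasurableSpace.comap (ξ i) inferInstance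

lemma measurable_past {t i : ℕ} (hi : i < t) : Measurable[past ξ t] (ξ i) :=
  (comap_measurable (ξ i)).mono (le_biSup (fun i => MeasurableSpace.comap (ξ i) inferInstance) hi)
    le_rfl

lemma measurable_shiryaevRoberts (hφ : Measurable φ) (t : ℕ) :
    Measurable[past ξ t] fun ω => shiryaevRoberts φ (fun i => ξ i ω) t := by
  unfold shiryaevRoberts
  refine Finset.measurable_fun_sum _ fun k _ => Finset.measurable_fun_prod _ fun i hi => ?_
  have := hφ.comp (measurable_past (ξ := ξ) (Finset.mem_Ico.1 hi).2)
  exact ENNReal.measurable_ofReal.comp (Real.measurable_exp.comp this.neg)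

lemma measurableSet_noAlarm (hφ : Measurable φ) (t : ℕ) :
    MeasurableSet[past ξ t] {ω | NoAlarm φ b (fun i => ξ i ω) t} := by
  simp only [NoAlarm, Set.ofPred_forall]
  refine .iInter fun s => .iInter fun hs => .iInter fun k => .iInter fun _ => ?_
  refine @measurableSet_lt _ _ _ _ _ (past ξ t) _ _ _ _ _ ?_ measurable_const
  refine Finset.measurable_fun_sum _ fun i hi => ?_
  exact (hφ.comp (measurable_past (ξ := ξ) ((Finset.mem_Ico.1 hi).2.trans_le hs))).neg

variable [MeasurableSpace Ω] {P : Measure Ω}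

lemma past_le (hmeas : ∀ i, Measurable (ξ i)) (t : ℕ) : past ξ t ≤ ‹MeasurableSpace Ω› :=
  iSup₂_le fun i _ => (hmeas i).comap_le

lemma indep_past [IsProbabilityMeasure P] (hmeas : ∀ i, Measurable (ξ i)) (hindep : iIndepFun ξ P)
    (t : ℕ) : Indep (past ξ t) (MeasurableSpace.comap (ξ t) inferInstance) P := by
  have := indep_iSup_of_disjoint (S := Set.Iio t) (T := {t}) (fun i => (hmeas i).comap_le)
    hindep.iIndep (by simp)
  simpa [past] using this

/-- On the event of no alarm, `1 + R_t` is a function of the past, so its mean factors from that of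
the new increment. The hypothesis `ε ≤ 1` allows the factor `ε` in front of `R_t` to be dropped. -/
lemma setLIntegral_shiryaevRoberts_succ_le [IsProbabilityMeasure P]
    (hφ : Measurable φ) (hmeas : ∀ i, Measurable (ξ i)) (hindep : iIndepFun ξ P)
    {ε : ℝ≥0∞} (hε : ε ≤ 1)
    (hL : ∀ i, ∫⁻ ω, ENNReal.ofReal (Real.exp (-φ (ξ i ω))) ∂P ≤ ε) (t : ℕ) :
    ∫⁻ ω in {ω | NoAlarm φ b (fun i => ξ i ω) t},
        shiryaevRoberts φ (fun i => ξ i ω) (t + 1) ∂P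
      ≤ ε * P {ω | NoAlarm φ b (fun i => ξ i ω) t}
        + ∫⁻ ω in {ω | NoAlarm φ b (fun i => ξ i ω) t},
            shiryaevRoberts φ (fun i => ξ i ω) t ∂P := by
  set A := {ω | NoAlarm φ b (fun i => ξ i ω) t}
  set R := fun ω => shiryaevRoberts φ (fun i => ξ i ω) t with hR
  have hA' : MeasurableSet[past ξ t] A := measurableSet_noAlarm hφ t
  have hA : MeasurableSet A := past_le hmeas t _ hA'
  have hRm : Measurable[past ξ t] R := measurable_shiryaevRoberts hφ t
  have hRm' : Measurable R := hRm.mono (past_le hmeas t) le_rfl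
  have hW : Measurable[past ξ t] (A.indicator fun ω => 1 + R ω) :=
    Measurable.indicator (measurable_const.add hRm) hA'
  have hLm : Measurable[MeasurableSpace.comap (ξ t) inferInstance]
      fun ω => ENNReal.ofReal (Real.exp (-φ (ξ t ω))) :=
    (show Measurable fun e => ENNReal.ofReal (Real.exp (-φ e)) by fun_prop).comp
      (comap_measurable (ξ t))
  have hkey := lintegral_mul_eq_lintegral_mul_lintegral_of_independent_measurableSpace
    (past_le hmeas t) (hmeas t).comap_le (indep_past hmeas hindep t) hW hLm
  have h1 : ∫⁻ ω in A, shiryaevRoberts φ (fun i => ξ i ω) (t + 1) ∂P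
      = ∫⁻ ω, A.indicator (fun ω => 1 + R ω) ω * ENNReal.ofReal (Real.exp (-φ (ξ t ω))) ∂P := by
    rw [← lintegral_indicator hA]
    refine lintegral_congr fun ω => ?_
    by_cases hω : ω ∈ A <;> simp [hω, shiryaevRoberts_succ, hR]
  have h2 : ∫⁻ ω, A.indicator (fun ω => 1 + R ω) ω ∂P = P A + ∫⁻ ω in A, R ω ∂P := by
    rw [lintegral_indicator hA, lintegral_add_left measurable_const]
    simp
  rw [h1, hkey, h2]
  calc _ ≤ (P A + ∫⁻ ω in A, R ω ∂P) * ε := by gcongr; exact hL t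
    _ = ε * P A + ε * ∫⁻ ω in A, R ω ∂P := by ring
    _ ≤ ε * P A + 1 * ∫⁻ ω in A, R ω ∂P := by gcongr
    _ = _ := by rw [one_mul]

/-- An optional stopping inequality by induction on `n`: the part of the no-alarm event lost at time
`n + 1` carries `R ≥ exp b`, so its integral pays for the new alarm probability. -/
lemma alarm_balance [IsProbabilityMeasure P]
    (hφ : Measurable φ) (hmeas : ∀ i, Measurable (ξ i)) (hindep : iIndepFun ξ P)
    {ε : ℝ≥0∞} (hε : ε ≤ 1)
    (hL : ∀ i, ∫⁻ ω, ENNReal.ofReal (Real.exp (-φ (ξ i ω))) ∂P ≤ ε) (n : ℕ) :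
    ENNReal.ofReal (Real.exp b) * P {ω | NoAlarm φ b (fun i => ξ i ω) n}ᶜ
        + ∫⁻ ω in {ω | NoAlarm φ b (fun i => ξ i ω) n},
            shiryaevRoberts φ (fun i => ξ i ω) n ∂P
      ≤ ε * ∑ t ∈ Finset.range n, P {ω | NoAlarm φ b (fun i => ξ i ω) t} := by
  induction n with
  -- At time zero there is no `k < s`, so no alarm is possible, and `R` is an empty sum.
  | zero => simp [NoAlarm, shiryaevRoberts]
  | succ n ih =>
    set A := fun n => {ω | NoAlarm φ b (fun i => ξ i ω) n} with hAdef
    set R := fun n ω => shiryaevRoberts φ (fun i => ξ i ω) n with hR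
    have hA : ∀ n, MeasurableSet (A n) := fun n =>
      past_le hmeas n _ (measurableSet_noAlarm hφ n)
    have hsub : A (n + 1) ⊆ A n := fun ω hω => NoAlarm.mono hω n.le_succ
    have hcompl : (A (n + 1))ᶜ = (A n)ᶜ ∪ (A n \ A (n + 1)) := by
      ext ω
      have := @hsub ω
      simp only [Set.mem_compl_iff, Set.mem_union, Set.mem_sdiff]
      tauto
    have hnew : ENNReal.ofReal (Real.exp b) * P (A n \ A (n + 1))
        ≤ ∫⁻ ω in A n \ A (n + 1), R (n + 1) ω ∂P := by
      rw [← setLIntegral_const]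
      refine setLIntegral_mono' ((hA n).diff (hA _)) fun ω hω => ?_
      have h2 : ¬ NoAlarm φ b (fun i => ξ i ω) (n + 1) := hω.2
      unfold NoAlarm at h2
      push Not at h2
      obtain ⟨s, hs, k, hk, hb⟩ := h2
      -- An alarm at some `s ≤ n` is excluded on this set, so the crossing happens exactly at `n +
      -- 1`.
      have hsn : s = n + 1 := by
        by_contra hne
        exact absurd hb (not_le.2 (hω.1 s (by omega) k hk))
      subst hsn
      exact ofReal_exp_le_shiryaevRoberts hk hb
    have hsplit : ∫⁻ ω in A n \ A (n + 1), R (n + 1) ω ∂P + ∫⁻ ω in A (n + 1), R (n + 1) ω ∂P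
        = ∫⁻ ω in A n, R (n + 1) ω ∂P := by
      rw [← lintegral_union (hA _) Set.disjoint_sdiff_left, Set.sdiff_union_of_subset hsub]
    calc _ ≤ ENNReal.ofReal (Real.exp b) * (P (A n)ᶜ + P (A n \ A (n + 1)))
          + ∫⁻ ω in A (n + 1), R (n + 1) ω ∂P := by
          change ENNReal.ofReal (Real.exp b) * P (A (n + 1))ᶜ
            + ∫⁻ ω in A (n + 1), R (n + 1) ω ∂P ≤ _
          rw [hcompl]
          gcongr
          exact measure_union_le _ _
      _ ≤ ENNReal.ofReal (Real.exp b) * P (A n)ᶜ + (∫⁻ ω in A n \ A (n + 1), R (n + 1) ω ∂P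
          + ∫⁻ ω in A (n + 1), R (n + 1) ω ∂P) := by
          rw [mul_add, add_assoc]
          gcongr
      _ = ENNReal.ofReal (Real.exp b) * P (A n)ᶜ + ∫⁻ ω in A n, R (n + 1) ω ∂P := by rw [hsplit]
      _ ≤ ENNReal.ofReal (Real.exp b) * P (A n)ᶜ
          + (ε * P (A n) + ∫⁻ ω in A n, R n ω ∂P) := by
          gcongr
          exact setLIntegral_shiryaevRoberts_succ_le hφ hmeas hindep hε hL n
      _ = (ENNReal.ofReal (Real.exp b) * P (A n)ᶜ + ∫⁻ ω in A n, R n ω ∂P) + ε * P (A n) := by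
          ring
      _ ≤ ε * ∑ t ∈ Finset.range n, P (A t) + ε * P (A n) := by gcongr
      _ = _ := by rw [Finset.sum_range_succ, mul_add]

/-- If the multiplicative increments `exp (-φ (ξ i))` of the CUSUM statistic have mean at most
`ε ≤ 1`, then the mean time to a false alarm is at least `exp b / ε`. -/
theorem exp_threshold_le_mul_lintegral_stoppingTime [IsProbabilityMeasure P]
    (hφ : Measurable φ) (hmeas : ∀ i, Measurable (ξ i)) (hindep : iIndepFun ξ P)
    {ε : ℝ≥0∞} (hε0 : ε ≠ 0) (hε : ε ≤ 1)
    (hL : ∀ i, ∫⁻ ω, ENNReal.ofReal (Real.exp (-φ (ξ i ω))) ∂P ≤ ε) :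
    ENNReal.ofReal (Real.exp b)
      ≤ ε * ∫⁻ ω, (stoppingTime φ b (fun i => ξ i ω) : ℝ≥0∞) ∂P := by
  classical
  set T := ∫⁻ ω, (stoppingTime φ b (fun i => ξ i ω) : ℝ≥0∞) ∂P with hT
  set A := fun n => {ω | NoAlarm φ b (fun i => ξ i ω) n} with hAdef
  have hA : ∀ n, MeasurableSet (A n) := fun n => past_le hmeas n _ (measurableSet_noAlarm hφ n)
  have hsum : ∀ n, ∑ t ∈ Finset.range n, P (A t) ≤ T := fun n => by
    calc ∑ t ∈ Finset.range n, P (A t)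
        = ∑ t ∈ Finset.range n, ∫⁻ ω, (A t).indicator 1 ω ∂P := by
          simp_rw [lintegral_indicator_one (hA _)]
      _ = ∫⁻ ω, ∑ t ∈ Finset.range n, (A t).indicator 1 ω ∂P :=
          (lintegral_finsetSum _ fun t _ => measurable_one.indicator (hA t)).symm
      _ ≤ T := lintegral_mono fun ω => by
          simpa [Set.indicator_apply, hAdef] using
            sum_indicator_noAlarm_le φ b (fun i => ξ i ω) n
  -- Here `ε ≠ 0` matters, since `0 * ∞ = 0`.
  by_cases htop : T = ∞
  · rw [htop, ENNReal.mul_top hε0]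
    exact le_top
  -- The no-alarm events decrease in `n`. With `T` finite this forces `P (A n) → 0`: an alarm comes
  -- almost surely.
  have hdecay : ∀ n : ℕ, n * P (A n) ≤ T := fun n => by
    refine le_trans ?_ (hsum n)
    rw [← nsmul_eq_mul]
    refine (le_of_eq (by simp)).trans
      (Finset.card_nsmul_le_sum (Finset.range n) _ (P (A n)) fun t ht => ?_)
    exact measure_mono fun ω hω => NoAlarm.mono hω (Finset.mem_range.1 ht).le
  have hzero : Filter.Tendsto (fun n => P (A n)) Filter.atTop (nhds 0) := by
    have hlim : Filter.Tendsto (fun n : ℕ => T / n) Filter.atTop (nhds 0) := by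
      simpa [div_eq_mul_inv] using
        ENNReal.Tendsto.const_mul ENNReal.tendsto_inv_nat_nhds_zero (Or.inr htop)
    refine tendsto_of_tendsto_of_tendsto_of_le_of_le' tendsto_const_nhds hlim
      (.of_forall fun _ => zero_le) ?_
    filter_upwards [Filter.eventually_gt_atTop 0] with n hn
    rw [ENNReal.le_div_iff_mul_le (Or.inl (by simpa using hn.ne')) (Or.inl (by simp)), mul_comm]
    exact hdecay n
  have hbound : ∀ n, ENNReal.ofReal (Real.exp b)
      ≤ ε * T + ENNReal.ofReal (Real.exp b) * P (A n) := fun n => by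
    calc ENNReal.ofReal (Real.exp b)
        = ENNReal.ofReal (Real.exp b) * P (A n)ᶜ + ENNReal.ofReal (Real.exp b) * P (A n) := by
          rw [← mul_add, add_comm, measure_add_measure_compl (hA n), measure_univ, mul_one]
      _ ≤ ε * T + ENNReal.ofReal (Real.exp b) * P (A n) := by
          refine add_le_add ?_ le_rfl
          exact (le_self_add.trans (alarm_balance hφ hmeas hindep hε hL n)).trans
            (mul_le_mul_right (hsum n) ε)
  have hlim : Filter.Tendsto (fun n => ε * T + ENNReal.ofReal (Real.exp b) * P (A n))
      Filter.atTop (nhds (ε * T + ENNReal.ofReal (Real.exp b) * 0)) :=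
    tendsto_const_nhds.add (ENNReal.Tendsto.const_mul hzero (Or.inr ENNReal.ofReal_ne_top))
  simpa using ge_of_tendsto' hlim hbound

end Cusum

/-! ### Exponential moments of quadratic functions of standard Gaussians -/

/-- Completing the square: the tilted standard density is a constant times the density of `N(w / a,
1 / a)`. -/
lemma lintegral_exp_quadratic_gaussianReal {a : ℝ} (ha : 0 < a) (w : ℝ) :
    ∫⁻ y, ENNReal.ofReal (Real.exp ((1 / 2) * (1 - a) * y ^ 2 + w * y)) ∂gaussianReal 0 1
      = ENNReal.ofReal (Real.exp (-(1 / 2) * Real.log a + (1 / 2) * (w ^ 2 / a))) := by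
  obtain ⟨s, hsa⟩ : ∃ s : NNReal, (s : ℝ) = a⁻¹ := ⟨_, Real.coe_toNNReal _ (inv_pos.2 ha).le⟩
  have hv : s ≠ 0 := by
    rintro rfl
    exact (inv_pos.2 ha).ne hsa
  rw [gaussianReal_of_var_ne_zero _ one_ne_zero,
    lintegral_withDensity_eq_lintegral_mul _ (measurable_gaussianPDF _ _) (by fun_prop)]
  have hpt : ∀ y : ℝ, (gaussianPDF 0 1 * fun y => ENNReal.ofReal
        (Real.exp ((1 / 2) * (1 - a) * y ^ 2 + w * y))) y
      = ENNReal.ofReal (Real.exp (-(1 / 2) * Real.log a + (1 / 2) * (w ^ 2 / a)))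
        * gaussianPDF (w / a) s y := by
    intro y
    have hsqrt : Real.exp (-(1 / 2) * Real.log a) = (√a)⁻¹ := by
      rw [Real.sqrt_eq_rpow, Real.rpow_def_of_pos ha, ← Real.exp_neg]
      ring_nf
    have hs : √(2 * Real.pi * a⁻¹) = √(2 * Real.pi) * (√a)⁻¹ := by
      rw [Real.sqrt_mul (by positivity), Real.sqrt_inv]
    have ha' : √a ≠ 0 := (Real.sqrt_pos.2 ha).ne'
    simp only [Pi.mul_apply, gaussianPDF, gaussianPDFReal]
    rw [← ENNReal.ofReal_mul (by positivity), ← ENNReal.ofReal_mul (by positivity)]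
    congr 1
    simp only [NNReal.coe_one, hsa, mul_one, sub_zero]
    rw [hs, Real.exp_add (-(1 / 2) * Real.log a), hsqrt, mul_inv, inv_inv, mul_assoc,
      ← Real.exp_add]
    have : Real.exp (-y ^ 2 / 2 + (1 / 2 * (1 - a) * y ^ 2 + w * y))
        = Real.exp (1 / 2 * (w ^ 2 / a)) * Real.exp (-(y - w / a) ^ 2 / (2 * a⁻¹)) := by
      rw [← Real.exp_add]
      congr 1
      field_simp
      ring
    rw [this]
    field_simp
  rw [lintegral_congr hpt, lintegral_const_mul _ (measurable_gaussianPDF _ _),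
    lintegral_gaussianPDF_eq_one _ hv, mul_one]

/-- The exponential moment of a quadratic function of a standard normal vector. -/
theorem lintegral_exp_quadratic_stdGaussian {ι : Type*} [Fintype ι] [DecidableEq ι]
    {A : Matrix ι ι ℝ} (hA : A.PosDef) (v : ι → ℝ) :
    ∫⁻ x, ENNReal.ofReal (Real.exp ((1 / 2) * (x.ofLp ⬝ᵥ ((1 - A) *ᵥ x.ofLp)) + v ⬝ᵥ x.ofLp))
        ∂stdGaussian (EuclideanSpace ℝ ι)
      = ENNReal.ofReal (Real.exp (-(1 / 2) * Real.log A.det + (1 / 2) * (v ⬝ᵥ (A⁻¹ *ᵥ v)))) := by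
  -- In an eigenbasis of `A` the coordinates are again independent standard normals, and the
  -- integral splits into one-dimensional ones.
  set e := hA.isHermitian.eigenvectorBasis with he
  set l := hA.isHermitian.eigenvalues with hl
  have hlpos : ∀ i, 0 < l i := hA.eigenvalues_pos
  have hdot : ∀ x y : EuclideanSpace ℝ ι, x.ofLp ⬝ᵥ y.ofLp = inner ℝ x y := fun x y => by
    rw [PiLp.inner_apply, dotProduct]
    simp [mul_comm]
  have hAe : ∀ i, toEuclideanCLM (𝕜 := ℝ) A (e i) = l i • e i := fun i => by
    apply WithLp.ofLp_injective
    rw [ofLp_toEuclideanCLM]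
    exact hA.isHermitian.mulVec_eigenvectorBasis i
  have hself : ∀ x y : EuclideanSpace ℝ ι, inner ℝ (toEuclideanCLM (𝕜 := ℝ) A x) y
      = inner ℝ x (toEuclideanCLM (𝕜 := ℝ) A y) := fun x y => by
    rw [← hdot, ← hdot, ofLp_toEuclideanCLM, ofLp_toEuclideanCLM, dotProduct_mulVec,
      ← mulVec_transpose, ← conjTranspose_eq_transpose_of_trivial, hA.isHermitian.eq]
  set w : ι → ℝ := fun i => inner ℝ (WithLp.toLp 2 v) (e i) with hw
  have hquad : ∀ y : ι → ℝ, (1 / 2) * ((∑ i, y i • e i).ofLp ⬝ᵥ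
        ((1 - A) *ᵥ (∑ i, y i • e i).ofLp)) + v ⬝ᵥ (∑ i, y i • e i).ofLp
      = ∑ i, ((1 / 2) * (1 - l i) * y i ^ 2 + w i * y i) := by
    intro y
    have h1 : (∑ i, y i • e i).ofLp ⬝ᵥ (∑ i, y i • e i).ofLp = ∑ i, y i ^ 2 := by
      rw [hdot, e.orthonormal.inner_sum]
      simp [sq]
    have h2 : (∑ i, y i • e i).ofLp ⬝ᵥ (A *ᵥ (∑ i, y i • e i).ofLp) = ∑ i, l i * y i ^ 2 := by
      rw [← ofLp_toEuclideanCLM, hdot, map_sum]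
      simp_rw [map_smul, hAe, smul_smul]
      rw [e.orthonormal.inner_sum]
      refine Finset.sum_congr rfl fun i _ => ?_
      simp only [conj_trivial]
      ring
    have h3 : v ⬝ᵥ (∑ i, y i • e i).ofLp = ∑ i, w i * y i := by
      have := hdot (WithLp.toLp 2 v) (∑ i, y i • e i)
      rw [show v ⬝ᵥ (∑ i, y i • e i).ofLp = _ from this, inner_sum]
      simp_rw [inner_smul_right, hw]
      exact Finset.sum_congr rfl fun i _ => mul_comm _ _
    rw [sub_mulVec, one_mulVec, dotProduct_sub, h1, h2, h3, Finset.sum_add_distrib,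
      ← Finset.sum_sub_distrib, Finset.mul_sum]
    congr 1
    exact Finset.sum_congr rfl fun i _ => by ring
  have hinv : v ⬝ᵥ (A⁻¹ *ᵥ v) = ∑ i, w i ^ 2 / l i := by
    set z : EuclideanSpace ℝ ι := WithLp.toLp 2 (A⁻¹ *ᵥ v) with hz
    have hAz : toEuclideanCLM (𝕜 := ℝ) A z = WithLp.toLp 2 v := by
      apply WithLp.ofLp_injective
      rw [ofLp_toEuclideanCLM, hz]
      simp only [mulVec_mulVec]
      rw [mul_nonsing_inv _ ((isUnit_iff_isUnit_det A).1 hA.isUnit), one_mulVec]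
    have hwz : ∀ i, w i = l i * inner ℝ z (e i) := fun i => by
      rw [hw]
      simp only
      rw [← hAz, hself, hAe, inner_smul_right]
    rw [show v ⬝ᵥ (A⁻¹ *ᵥ v) = inner ℝ (WithLp.toLp 2 v) z from hdot (WithLp.toLp 2 v) z,
      ← e.sum_inner_mul_inner]
    refine Finset.sum_congr rfl fun i _ => ?_
    have hli := (hlpos i).ne'
    change w i * _ = _
    rw [real_inner_comm, hwz i]
    field_simp
  have hexp : ∀ y : ι → ℝ, ENNReal.ofReal (Real.exp ((1 / 2) * ((∑ i, y i • e i).ofLp ⬝ᵥ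
        ((1 - A) *ᵥ (∑ i, y i • e i).ofLp)) + v ⬝ᵥ (∑ i, y i • e i).ofLp))
      = ∏ i, ENNReal.ofReal (Real.exp ((1 / 2) * (1 - l i) * y i ^ 2 + w i * y i)) := fun y => by
    rw [hquad, Real.exp_sum, ENNReal.ofReal_prod_of_nonneg fun _ _ => (Real.exp_pos _).le]
  have hcont : Continuous fun x : EuclideanSpace ℝ ι =>
      (1 / 2) * (x.ofLp ⬝ᵥ ((1 - A) *ᵥ x.ofLp)) + v ⬝ᵥ x.ofLp := by
    simp only [dotProduct, mulVec]
    fun_prop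
  rw [stdGaussian_eq_map_pi_orthonormalBasis e, lintegral_map (by
    exact ENNReal.measurable_ofReal.comp (Real.measurable_exp.comp hcont.measurable))
    (by fun_prop), lintegral_congr hexp]
  have hmeas : ∀ i, Measurable fun y : ℝ =>
      ENNReal.ofReal (Real.exp ((1 / 2) * (1 - l i) * y ^ 2 + w i * y)) := fun i => by fun_prop
  rw [lintegral_prod_eq_prod_lintegral_of_indepFun Finset.univ
    (fun i (y : ι → ℝ) => ENNReal.ofReal (Real.exp ((1 / 2) * (1 - l i) * y i ^ 2 + w i * y i)))
    (iIndepFun_pi fun i => (hmeas i).aemeasurable) fun i => (hmeas i).comp (measurable_pi_apply i)]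
  have hcoord : ∀ i, ∫⁻ y : ι → ℝ, ENNReal.ofReal (Real.exp ((1 / 2) * (1 - l i) * y i ^ 2
        + w i * y i)) ∂Measure.pi (fun _ : ι => gaussianReal 0 1)
      = ENNReal.ofReal (Real.exp (-(1 / 2) * Real.log (l i) + (1 / 2) * (w i ^ 2 / l i))) :=
    fun i => by
      rw [(measurePreserving_eval (fun _ : ι => gaussianReal 0 1) i).lintegral_comp (hmeas i),
        lintegral_exp_quadratic_gaussianReal (hlpos i)]
  rw [Finset.prod_congr rfl fun i _ => hcoord i,
    ← ENNReal.ofReal_prod_of_nonneg fun _ _ => (Real.exp_pos _).le, ← Real.exp_sum, hinv,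
    hA.isHermitian.det_eq_prod_eigenvalues]
  simp only [RCLike.ofReal_real_eq_id, id_eq]
  rw [Real.log_prod fun i _ => (hlpos i).ne', Finset.sum_add_distrib, Finset.mul_sum,
    Finset.mul_sum]

/-! ### Log-determinant, spectral norm and Frobenius norm estimates -/

section MatrixBounds

variable {d : ℕ} {A B S Q : Matrix (Fin d) (Fin d) ℝ}

/-- Sum `log x ≤ x - 1` over the eigenvalues. -/
lemma log_det_le_trace_sub_card (hA : A.PosDef) : Real.log A.det ≤ A.trace - d := by
  rw [hA.isHermitian.det_eq_prod_eigenvalues, hA.isHermitian.trace_eq_sum_eigenvalues]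
  simp only [RCLike.ofReal_real_eq_id, id_eq]
  rw [Real.log_prod fun i _ => (hA.eigenvalues_pos i).ne']
  calc _ ≤ ∑ i, (hA.isHermitian.eigenvalues i - 1) :=
        Finset.sum_le_sum fun i _ => Real.log_le_sub_one_of_pos (hA.eigenvalues_pos i)
    _ = _ := by simp

open scoped MatrixOrder in
lemma msqrt_mul_self (hA : A.PosSemidef) : msqrt A * msqrt A = A :=
  CFC.sqrt_mul_sqrt_self A hA.nonneg

open scoped MatrixOrder in
lemma transpose_msqrt (A : Matrix (Fin d) (Fin d) ℝ) : (msqrt A)ᵀ = msqrt A := by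
  rw [← conjTranspose_eq_transpose_of_trivial]
  exact (CFC.sqrt_nonneg A).posSemidef.isHermitian.eq

lemma isUnit_det_msqrt (hA : A.PosDef) : IsUnit (msqrt A).det := by
  have h : (msqrt A).det * (msqrt A).det = A.det := by
    rw [← det_mul, msqrt_mul_self hA.posSemidef]
  exact isUnit_iff_ne_zero.2 fun h0 => hA.det_pos.ne' (by rw [← h, h0, zero_mul])

/-- Concavity of `log det` on positive definite matrices, in gradient form. -/
lemma log_det_le_add_trace (hA : A.PosDef) (hB : B.PosDef) :
    Real.log B.det ≤ Real.log A.det + (A⁻¹ * (B - A)).trace := by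
  -- Conjugation by `A^(-1/2)` reduces to the tangent at the identity.
  set C := msqrt A⁻¹ with hC
  have hCT : Cᴴ = C := by rw [conjTranspose_eq_transpose_of_trivial, hC, transpose_msqrt]
  have hAC : A⁻¹ = Cᴴ * C := by rw [hCT, hC, msqrt_mul_self hA.inv.posSemidef]
  have hM : (C * B * Cᴴ).PosDef := by
    refine hB.mul_mul_conjTranspose_same ?_
    rw [vecMul_injective_iff_isUnit, isUnit_iff_isUnit_det]
    exact isUnit_det_msqrt hA.inv
  have hAu : IsUnit A.det := (isUnit_iff_isUnit_det A).1 hA.isUnit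
  have hdet : (C * B * Cᴴ).det = A.det⁻¹ * B.det := by
    have : (A⁻¹).det = C.det * Cᴴ.det := by rw [hAC, det_mul, mul_comm]
    rw [det_mul, det_mul, ← Ring.inverse_eq_inv', ← det_nonsing_inv, this]
    ring
  have htr : (C * B * Cᴴ).trace = (A⁻¹ * B).trace := by
    rw [trace_mul_comm, ← mul_assoc, ← hAC]
  have := log_det_le_trace_sub_card hM
  rw [hdet, htr, Real.log_mul (inv_ne_zero hA.det_pos.ne') hB.det_pos.ne', Real.log_inv] at this
  rw [mul_sub, nonsing_inv_mul _ hAu, trace_sub, trace_one, Fintype.card_fin]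
  linarith

lemma specNorm_nonneg (A : Matrix (Fin d) (Fin d) ℝ) : 0 ≤ specNorm A := norm_nonneg _

lemma specNorm_mul_le (A B : Matrix (Fin d) (Fin d) ℝ) :
    specNorm (A * B) ≤ specNorm A * specNorm B := by
  rw [specNorm, map_mul]
  exact norm_mul_le _ _

lemma specNorm_add_le (A B : Matrix (Fin d) (Fin d) ℝ) :
    specNorm (A + B) ≤ specNorm A + specNorm B := by
  rw [specNorm, map_add]
  exact norm_add_le _ _

lemma specNorm_one_le : specNorm (1 : Matrix (Fin d) (Fin d) ℝ) ≤ 1 := by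
  rw [specNorm, map_one]
  exact ContinuousLinearMap.norm_id_le

open scoped Matrix.Norms.L2Operator in
lemma specNorm_transpose (A : Matrix (Fin d) (Fin d) ℝ) : specNorm Aᵀ = specNorm A := by
  have := l2_opNorm_conjTranspose A
  rwa [conjTranspose_eq_transpose_of_trivial] at this

lemma sum_sq_mulVec_le (A : Matrix (Fin d) (Fin d) ℝ) (x : Fin d → ℝ) :
    ∑ i, (A *ᵥ x) i ^ 2 ≤ specNorm A ^ 2 * ∑ i, x i ^ 2 := by
  have h := (toEuclideanCLM (𝕜 := ℝ) A).le_opNorm (WithLp.toLp 2 x)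
  have h2 := pow_le_pow_left₀ (norm_nonneg _) h 2
  rw [mul_pow, EuclideanSpace.real_norm_sq_eq, EuclideanSpace.real_norm_sq_eq,
    ofLp_toEuclideanCLM] at h2
  exact h2

lemma abs_dotProduct_mulVec_le (A : Matrix (Fin d) (Fin d) ℝ) (x : Fin d → ℝ) :
    |x ⬝ᵥ (A *ᵥ x)| ≤ specNorm A * (x ⬝ᵥ x) := by
  have h1 := abs_real_inner_le_norm (WithLp.toLp 2 x) (toEuclideanCLM (𝕜 := ℝ) A (WithLp.toLp 2 x))
  rw [inner_toEuclideanCLM] at h1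
  have h2 := (toEuclideanCLM (𝕜 := ℝ) A).le_opNorm (WithLp.toLp 2 x)
  have h3 : ‖WithLp.toLp 2 x‖ ^ 2 = x ⬝ᵥ x := by
    rw [EuclideanSpace.real_norm_sq_eq, dotProduct]
    simp [sq]
  calc _ ≤ _ := h1
    _ ≤ ‖WithLp.toLp 2 x‖ * (specNorm A * ‖WithLp.toLp 2 x‖) := by gcongr; exact h2
    _ = _ := by rw [← h3]; ring

lemma posDef_one_sub (hS : S.IsSymm) (h : specNorm S < 1) : (1 - S).PosDef := by
  refine PosDef.of_dotProduct_mulVec_pos ?_ fun x hx => ?_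
  · rw [IsHermitian, conjTranspose_eq_transpose_of_trivial, transpose_sub, transpose_one, hS.eq]
  · have hpos : 0 < x ⬝ᵥ x := by simpa using dotProduct_star_self_pos_iff.2 hx
    have := (abs_le.1 (abs_dotProduct_mulVec_le S x)).2
    rw [star_trivial, sub_mulVec, one_mulVec, dotProduct_sub]
    nlinarith

/-- For a symmetric operator the norm is the supremum of the absolute Rayleigh quotients, which the
Loewner bounds control. -/
lemma specNorm_le_of_loewnerLE {β : ℝ} (hβ : 0 ≤ β) (hS : S.IsSymm)
    (h1 : LoewnerLE (-(β • 1)) S) (h2 : LoewnerLE S (β • 1)) : specNorm S ≤ β := by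
  have hsymm : ((toEuclideanCLM (𝕜 := ℝ) S : EuclideanSpace ℝ (Fin d) →L[ℝ] _) :
      EuclideanSpace ℝ (Fin d) →ₗ[ℝ] _).IsSymmetric := by
    intro x y
    have hdot : ∀ x y : EuclideanSpace ℝ (Fin d), inner ℝ x y = x.ofLp ⬝ᵥ y.ofLp := fun x y => by
      rw [PiLp.inner_apply, dotProduct]
      simp [mul_comm]
    simp only [ContinuousLinearMap.coe_coe]
    rw [hdot, hdot, ofLp_toEuclideanCLM, ofLp_toEuclideanCLM, dotProduct_mulVec,
      ← mulVec_transpose, hS.eq]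
  rw [specNorm, ContinuousLinearMap.norm_eq_iSup_rayleighQuotient _ hsymm]
  refine ciSup_le fun x => ?_
  have hx : x.ofLp ⬝ᵥ x.ofLp = ‖x‖ ^ 2 := by
    rw [EuclideanSpace.real_norm_sq_eq, dotProduct]
    simp [sq]
  have h1' := h1.dotProduct_mulVec_nonneg x.ofLp
  have h2' := h2.dotProduct_mulVec_nonneg x.ofLp
  rw [star_trivial] at h1' h2'
  rw [sub_neg_eq_add, add_mulVec, dotProduct_add, smul_mulVec, one_mulVec, dotProduct_smul, hx,
    smul_eq_mul] at h1'
  rw [sub_mulVec, dotProduct_sub, smul_mulVec, one_mulVec, dotProduct_smul, hx, smul_eq_mul] at h2'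
  rw [ContinuousLinearMap.rayleighQuotient, ContinuousLinearMap.reApplyInnerSelf_apply,
    real_inner_comm, inner_toEuclideanCLM, abs_div, abs_sq]
  refine div_le_of_le_mul₀ (sq_nonneg _) hβ (abs_le.2 ⟨?_, ?_⟩)
  · simp only [RCLike.re_to_real]
    linarith
  · simp only [RCLike.re_to_real]
    linarith

lemma frobNorm_nonneg (A : Matrix (Fin d) (Fin d) ℝ) : 0 ≤ frobNorm A := Real.sqrt_nonneg _

lemma frobNorm_sq (A : Matrix (Fin d) (Fin d) ℝ) : frobNorm A ^ 2 = ∑ i, ∑ j, A i j ^ 2 :=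
  Real.sq_sqrt (Finset.sum_nonneg fun _ _ => Finset.sum_nonneg fun _ _ => sq_nonneg _)

lemma frobNorm_transpose (A : Matrix (Fin d) (Fin d) ℝ) : frobNorm Aᵀ = frobNorm A := by
  rw [frobNorm, frobNorm, Finset.sum_comm]
  rfl

open scoped Matrix.Norms.Frobenius in
lemma frobNorm_add_le (A B : Matrix (Fin d) (Fin d) ℝ) :
    frobNorm (A + B) ≤ frobNorm A + frobNorm B := by
  have h : ∀ M : Matrix (Fin d) (Fin d) ℝ, frobNorm M = ‖M‖ := fun M => by
    rw [frobNorm, frobenius_norm_def, Real.sqrt_eq_rpow]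
    simp
  rw [h, h, h]
  exact norm_add_le A B

lemma frobNorm_mul_le (A B : Matrix (Fin d) (Fin d) ℝ) :
    frobNorm (A * B) ≤ specNorm A * frobNorm B := by
  refine le_of_sq_le_sq ?_ (mul_nonneg (specNorm_nonneg A) (frobNorm_nonneg B))
  rw [mul_pow, frobNorm_sq, frobNorm_sq, Finset.sum_comm, Finset.sum_comm (s := Finset.univ)
    (t := Finset.univ) (f := fun i j => B i j ^ 2), Finset.mul_sum]
  exact Finset.sum_le_sum fun j _ => sum_sq_mulVec_le A fun i => B i j

lemma frobNorm_mul_le' (A B : Matrix (Fin d) (Fin d) ℝ) :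
    frobNorm (A * B) ≤ frobNorm A * specNorm B := by
  rw [← frobNorm_transpose, transpose_mul, mul_comm, ← specNorm_transpose B, ← frobNorm_transpose A]
  exact frobNorm_mul_le _ _

lemma trace_mul_le_frobNorm_mul (A B : Matrix (Fin d) (Fin d) ℝ) :
    (A * B).trace ≤ frobNorm A * frobNorm B := by
  have h := Real.sum_mul_le_sqrt_mul_sqrt (Finset.univ : Finset (Fin d × Fin d))
    (fun p => A p.1 p.2) (fun p => Bᵀ p.1 p.2)
  rw [← frobNorm_transpose B]
  simpa [Fintype.sum_prod_type, trace, mul_apply, frobNorm] using h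

/-- The identity `K = 1 + K S` for `K = (1 - S)⁻¹` bounds `‖K‖` by `1 + ‖K‖ ‖S‖`. -/
lemma specNorm_inv_one_sub_le (hS : S.IsSymm) (h : specNorm S < 1) :
    specNorm (1 - S)⁻¹ ≤ 1 / (1 - specNorm S) := by
  have hu : IsUnit (1 - S).det := (isUnit_iff_isUnit_det _).1 (posDef_one_sub hS h).isUnit
  have hK : (1 - S)⁻¹ = 1 + (1 - S)⁻¹ * S := by
    have := nonsing_inv_mul _ hu
    rw [mul_sub, mul_one] at this
    exact sub_eq_iff_eq_add.1 this
  have h1 : specNorm (1 - S)⁻¹ ≤ 1 + specNorm (1 - S)⁻¹ * specNorm S := by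
    calc specNorm (1 - S)⁻¹ = specNorm (1 + (1 - S)⁻¹ * S) := by rw [← hK]
      _ ≤ specNorm 1 + specNorm ((1 - S)⁻¹ * S) := specNorm_add_le _ _
      _ ≤ _ := add_le_add specNorm_one_le (specNorm_mul_le _ _)
  rw [le_div_iff₀ (by linarith)]
  linarith

/-- Comparison of `-½ log det (1 - S)` before and after a contraction `Q` at distance `δ` from the
identity. -/
theorem neg_half_log_det_conj_le {δ : ℝ} (hS : S.IsSymm) (hS1 : specNorm S < 1)
    (hQ : specNorm Q ≤ 1) (hQδ : specNorm (Q - 1) ≤ δ) :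
    -(1 / 2) * Real.log (1 - Q * S * Qᵀ).det
      ≤ -(1 / 2) * Real.log (1 - S).det + (1 / 2) * (Q * S * Qᵀ - S).trace
        + δ * (2 + δ) / (2 * (1 - specNorm S)) * frobNorm S ^ 2 := by
  set G := Q * S * Qᵀ with hG
  have hδ : 0 ≤ δ := (specNorm_nonneg _).trans hQδ
  have hGsymm : G.IsSymm := by
    rw [IsSymm, hG, transpose_mul, transpose_mul, transpose_transpose, hS.eq, mul_assoc]
  have hQS : frobNorm (Q * S) ≤ frobNorm S :=
    (frobNorm_mul_le _ _).trans (mul_le_of_le_one_left (frobNorm_nonneg _) hQ)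
  have hGF : frobNorm G ≤ frobNorm S := by
    refine (frobNorm_mul_le' _ _).trans ?_
    rw [specNorm_transpose]
    exact (mul_le_of_le_one_right (frobNorm_nonneg _) hQ).trans hQS
  have hGn : specNorm G ≤ specNorm S := by
    refine (specNorm_mul_le _ _).trans ?_
    rw [specNorm_transpose]
    refine (mul_le_of_le_one_right (specNorm_nonneg _) hQ).trans ?_
    exact (specNorm_mul_le _ _).trans (mul_le_of_le_one_left (specNorm_nonneg _) hQ)
  have hG1 : specNorm G < 1 := hGn.trans_lt hS1
  have hGu : IsUnit (1 - G).det := (isUnit_iff_isUnit_det _).1 (posDef_one_sub hGsymm hG1).isUnit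
  have hdiff : frobNorm (G - S) ≤ δ * (2 + δ) * frobNorm S := by
    -- As `Q` is a contraction, each summand costs `δ ‖S‖_F`. The total `2 δ` is below the constant
    -- `δ (2 + δ)` of `Φ`.
    have hsplit : G - S = (Q - 1) * S * Qᵀ + S * (Q - 1)ᵀ := by
      rw [hG, transpose_sub, transpose_one]
      noncomm_ring
    have h1 : frobNorm ((Q - 1) * S * Qᵀ) ≤ δ * frobNorm S := by
      refine (frobNorm_mul_le' _ _).trans ?_
      rw [specNorm_transpose]
      refine (mul_le_of_le_one_right (frobNorm_nonneg _) hQ).trans ?_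
      exact (frobNorm_mul_le _ _).trans (mul_le_mul_of_nonneg_right hQδ (frobNorm_nonneg _))
    have h2 : frobNorm (S * (Q - 1)ᵀ) ≤ frobNorm S * δ := by
      refine (frobNorm_mul_le' _ _).trans ?_
      rw [specNorm_transpose]
      exact mul_le_mul_of_nonneg_left hQδ (frobNorm_nonneg _)
    rw [hsplit]
    refine (frobNorm_add_le _ _).trans ?_
    nlinarith [mul_nonneg (mul_nonneg hδ hδ) (frobNorm_nonneg S)]
  have hK : frobNorm ((1 - G)⁻¹ * G) ≤ 1 / (1 - specNorm S) * frobNorm S := by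
    refine (frobNorm_mul_le _ _).trans ?_
    refine mul_le_mul ((specNorm_inv_one_sub_le hGsymm hG1).trans ?_) hGF (frobNorm_nonneg _)
      (by have : 0 < 1 - specNorm S := by linarith
          positivity)
    exact one_div_le_one_div_of_le (by linarith) (by linarith)
  have hcs : ((1 - G)⁻¹ * G * (G - S)).trace
      ≤ 1 / (1 - specNorm S) * frobNorm S * (δ * (2 + δ) * frobNorm S) :=
    (trace_mul_le_frobNorm_mul _ _).trans
      (mul_le_mul hK hdiff (frobNorm_nonneg _) ((frobNorm_nonneg _).trans hK))
  -- The tangent is taken at `1 - G`, so that concavity bounds `-log det (1 - G)` from above. Its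
  -- linear term is the trace of `G - S` plus a remainder estimated by `hcs`.
  have hgrad := log_det_le_add_trace (posDef_one_sub hGsymm hG1) (posDef_one_sub hS hS1)
  have hid : (1 - G)⁻¹ * ((1 - S) - (1 - G)) = (G - S) + (1 - G)⁻¹ * G * (G - S) := by
    have h1 : (1 - G)⁻¹ * G = (1 - G)⁻¹ - 1 := by
      have := nonsing_inv_mul _ hGu
      rw [mul_sub, mul_one] at this
      rw [sub_eq_iff_eq_add] at this
      exact eq_sub_of_add_eq (by rw [add_comm]; exact this.symm)
    rw [h1]
    noncomm_ring
  rw [hid, trace_add] at hgrad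
  have hrw : δ * (2 + δ) / (2 * (1 - specNorm S)) * frobNorm S ^ 2
      = (1 / 2) * (1 / (1 - specNorm S) * frobNorm S * (δ * (2 + δ) * frobNorm S)) := by
    have : 1 - specNorm S ≠ 0 := by linarith
    field_simp
  rw [hrw]
  linarith

end MatrixBounds

/-! ### Antitonicity of the matrix inverse -/

section Inverse

variable {ι : Type*} [Fintype ι] [DecidableEq ι] {X Y : Matrix ι ι ℝ}

/-- The inverse is antitone on positive definite matrices. -/
lemma dotProduct_inv_mulVec_le (hX : X.PosDef) (hY : Y.PosDef) (hXY : (Y - X).PosSemidef)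
    (p : ι → ℝ) : p ⬝ᵥ (Y⁻¹ *ᵥ p) ≤ p ⬝ᵥ (X⁻¹ *ᵥ p) := by
  set x := X⁻¹ *ᵥ p with hx
  set y := Y⁻¹ *ᵥ p with hy
  have hXx : X *ᵥ x = p := by
    rw [hx, mulVec_mulVec, mul_nonsing_inv _ ((isUnit_iff_isUnit_det X).1 hX.isUnit), one_mulVec]
  have hYy : Y *ᵥ y = p := by
    rw [hy, mulVec_mulVec, mul_nonsing_inv _ ((isUnit_iff_isUnit_det Y).1 hY.isUnit), one_mulVec]
  have hxXy : x ⬝ᵥ (X *ᵥ y) = p ⬝ᵥ y := by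
    rw [dotProduct_mulVec, ← mulVec_transpose, ← conjTranspose_eq_transpose_of_trivial,
      hX.isHermitian.eq, hXx]
  -- Expand `0 ≤ (x - y)ᵀ X (x - y) = p·x - 2 p·y + yᵀ X y` and use `yᵀ X y ≤ yᵀ Y y = p·y`.
  have h1 := hX.posSemidef.dotProduct_mulVec_nonneg (x - y)
  have h2 := hXY.dotProduct_mulVec_nonneg y
  rw [star_trivial, mulVec_sub, hXx, dotProduct_sub, sub_dotProduct, sub_dotProduct, hxXy] at h1
  rw [star_trivial, sub_mulVec, hYy, dotProduct_sub] at h2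
  rw [dotProduct_comm x p, dotProduct_comm y p] at h1
  rw [dotProduct_comm y p] at h2
  linarith

lemma posSemidef_inv_sub_inv (hX : X.PosDef) (hY : Y.PosDef) (hXY : (Y - X).PosSemidef) :
    (X⁻¹ - Y⁻¹).PosSemidef := by
  refine PosSemidef.of_dotProduct_mulVec_nonneg
    (hX.inv.isHermitian.sub hY.inv.isHermitian) fun p => ?_
  rw [star_trivial, sub_mulVec, dotProduct_sub, sub_nonneg]
  exact dotProduct_inv_mulVec_le hX hY hXY p

end Inverse

/-! ### Domination of Gaussian exponential moments by `Φ` -/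

section GaussianBound

variable {d : ℕ}

lemma specNorm_le_one_of_posSemidef {Q : Matrix (Fin d) (Fin d) ℝ}
    (hQ : (1 - Qᵀ * Q).PosSemidef) : specNorm Q ≤ 1 := by
  refine ContinuousLinearMap.opNorm_le_bound _ zero_le_one fun x => ?_
  rw [one_mul]
  refine le_of_sq_le_sq ?_ (norm_nonneg _)
  have hsq : ∀ y : EuclideanSpace ℝ (Fin d), ‖y‖ ^ 2 = y.ofLp ⬝ᵥ y.ofLp := fun y => by
    rw [EuclideanSpace.real_norm_sq_eq, dotProduct]
    simp [sq]
  have h := hQ.dotProduct_mulVec_nonneg x.ofLp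
  rw [star_trivial, sub_mulVec, one_mulVec, dotProduct_sub, ← mulVec_mulVec, dotProduct_mulVec,
    vecMul_transpose] at h
  rw [hsq, hsq, ofLp_toEuclideanCLM]
  linarith

/-- The exponential moment of a quadratic function of a normal vector. -/
theorem lintegral_exp_quadratic_multivariateGaussian (u : EuclideanSpace ℝ (Fin d))
    {Θ G : Matrix (Fin d) (Fin d) ℝ} (g : Fin d → ℝ) (hG : G.IsSymm)
    (hA : (1 - msqrt Θ * G * msqrt Θ).PosDef) :
    ∫⁻ x, ENNReal.ofReal (Real.exp ((1 / 2) * (x.ofLp ⬝ᵥ (G *ᵥ x.ofLp)) + g ⬝ᵥ x.ofLp))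
        ∂multivariateGaussian u Θ
      = ENNReal.ofReal (Real.exp (-(1 / 2) * Real.log (1 - msqrt Θ * G * msqrt Θ).det
          + (1 / 2) * (u.ofLp ⬝ᵥ (G *ᵥ u.ofLp) + 2 * (g ⬝ᵥ u.ofLp)
            + (msqrt Θ *ᵥ (G *ᵥ u.ofLp + g)) ⬝ᵥ ((1 - msqrt Θ * G * msqrt Θ)⁻¹ *ᵥ
                (msqrt Θ *ᵥ (G *ᵥ u.ofLp + g)))))) := by
  set R := msqrt Θ with hR
  set v := R *ᵥ (G *ᵥ u.ofLp + g) with hv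
  have hcont : Continuous fun x : EuclideanSpace ℝ (Fin d) =>
      (1 / 2) * (x.ofLp ⬝ᵥ (G *ᵥ x.ofLp)) + g ⬝ᵥ x.ofLp := by
    simp only [dotProduct, mulVec]
    fun_prop
  have hRT : ∀ a b : Fin d → ℝ, a ⬝ᵥ (R *ᵥ b) = (R *ᵥ a) ⬝ᵥ b := fun a b => by
    rw [dotProduct_mulVec, ← mulVec_transpose, transpose_msqrt]
  have hGT : ∀ a b : Fin d → ℝ, a ⬝ᵥ (G *ᵥ b) = (G *ᵥ a) ⬝ᵥ b := fun a b => by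
    rw [dotProduct_mulVec, ← mulVec_transpose, hG.eq]
  -- The law is the image of the standard Gaussian under `x ↦ u + R x`; this expands the exponent
  -- there.
  have hexp : ∀ x : EuclideanSpace ℝ (Fin d),
      (1 / 2) * ((u + toEuclideanCLM (𝕜 := ℝ) R x).ofLp ⬝ᵥ
          (G *ᵥ (u + toEuclideanCLM (𝕜 := ℝ) R x).ofLp))
        + g ⬝ᵥ (u + toEuclideanCLM (𝕜 := ℝ) R x).ofLp
      = (1 / 2) * (u.ofLp ⬝ᵥ (G *ᵥ u.ofLp) + 2 * (g ⬝ᵥ u.ofLp))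
        + ((1 / 2) * (x.ofLp ⬝ᵥ ((1 - (1 - R * G * R)) *ᵥ x.ofLp)) + v ⬝ᵥ x.ofLp) := by
    intro x
    rw [WithLp.ofLp_add, ofLp_toEuclideanCLM, sub_sub_cancel, ← mulVec_mulVec, ← mulVec_mulVec,
      hRT x.ofLp, hv, ← hRT _ x.ofLp, mulVec_add, dotProduct_add, add_dotProduct, dotProduct_add,
      add_dotProduct, add_dotProduct, hGT u.ofLp (R *ᵥ x.ofLp),
      dotProduct_comm (R *ᵥ x.ofLp) (G *ᵥ u.ofLp)]
    ring
  have hmeas : Measurable fun x : EuclideanSpace ℝ (Fin d) => ENNReal.ofReal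
      (Real.exp ((1 / 2) * (x.ofLp ⬝ᵥ (G *ᵥ x.ofLp)) + g ⬝ᵥ x.ofLp)) :=
    ENNReal.measurable_ofReal.comp (Real.measurable_exp.comp hcont.measurable)
  have hexp' : ∀ x : EuclideanSpace ℝ (Fin d), ENNReal.ofReal (Real.exp
      ((1 / 2) * ((u + toEuclideanCLM (𝕜 := ℝ) R x).ofLp ⬝ᵥ
          (G *ᵥ (u + toEuclideanCLM (𝕜 := ℝ) R x).ofLp))
        + g ⬝ᵥ (u + toEuclideanCLM (𝕜 := ℝ) R x).ofLp))
      = ENNReal.ofReal (Real.exp ((1 / 2) * (u.ofLp ⬝ᵥ (G *ᵥ u.ofLp) + 2 * (g ⬝ᵥ u.ofLp))))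
        * ENNReal.ofReal (Real.exp
          ((1 / 2) * (x.ofLp ⬝ᵥ ((1 - (1 - R * G * R)) *ᵥ x.ofLp)) + v ⬝ᵥ x.ofLp)) := fun x => by
    rw [hexp, Real.exp_add, ENNReal.ofReal_mul (Real.exp_pos _).le]
  rw [multivariateGaussian, lintegral_map hmeas (by fun_prop)]
  change ∫⁻ x, ENNReal.ofReal (Real.exp ((1 / 2) * ((u + toEuclideanCLM (𝕜 := ℝ) R x).ofLp ⬝ᵥ
          (G *ᵥ (u + toEuclideanCLM (𝕜 := ℝ) R x).ofLp))
        + g ⬝ᵥ (u + toEuclideanCLM (𝕜 := ℝ) R x).ofLp)) ∂_ = _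
  rw [lintegral_congr hexp', lintegral_const_mul' _ _ ENNReal.ofReal_ne_top,
    lintegral_exp_quadratic_stdGaussian hA v, ← ENNReal.ofReal_mul (Real.exp_pos _).le,
    ← Real.exp_add]
  congr 2
  ring

namespace UncertaintyData

variable {D : UncertaintyData d}

lemma Admissible.posDef_Θs (hD : D.Admissible) {Θ : Matrix (Fin d) (Fin d) ℝ} (hΘ : Θ ∈ D.U) :
    D.Θs.PosDef := by
  have := (hD.posDef_U Θ hΘ).add_posSemidef (hD.le_Θs Θ hΘ)
  rwa [add_sub_cancel] at this

/-- The first class enters the objective through `(-h, -H)`. -/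
lemma neg_mem_detectorSet {g : Fin d → ℝ} {G : Matrix (Fin d) (Fin d) ℝ}
    (h : (g, G) ∈ D.detectorSet) : (-g, -G) ∈ D.detectorSet := by
  obtain ⟨h1, h2, h3⟩ := h
  refine ⟨?_, ?_, ?_⟩
  · exact h1.neg
  · simpa [LoewnerLE, sub_eq_add_neg, add_comm] using h3
  · simpa [LoewnerLE, sub_eq_add_neg, add_comm] using h2

/-- Compactness of `Z` bounds the traces above, so `sSup` is a genuine supremum. -/
lemma Admissible.trace_le_supportFun (hD : D.Admissible) (Y : LiftedMatrix d) {Z : LiftedMatrix d}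
    (hZ : Z ∈ D.Z) : (Z * Y).trace ≤ D.supportFun Y := by
  refine le_csSup ?_ ⟨Z, hZ, rfl⟩
  have hcont : Continuous fun Z : LiftedMatrix d => (Z * Y).trace := by fun_prop
  exact (hD.compact_Z.image hcont).bddAbove

/-- For `z = [u; 1]` the trace is the quadratic form at `z`, and `[G, g] z = G u + g`: this recovers
the mean-dependent part of the Gaussian exponent. -/
lemma trace_vecMulVec_mul_lifted (u g : Fin d → ℝ) (G N : Matrix (Fin d) (Fin d) ℝ) :
    (vecMulVec (Sum.elim u (1 : Unit → ℝ)) (Sum.elim u (1 : Unit → ℝ)) *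
        (fromBlocks G (replicateCol Unit g) (replicateRow Unit g) 0
          + (appendCol g G)ᵀ * N * appendCol g G)).trace
      = u ⬝ᵥ (G *ᵥ u) + 2 * (g ⬝ᵥ u) + (G *ᵥ u + g) ⬝ᵥ (N *ᵥ (G *ᵥ u + g)) := by
  set z : Fin d ⊕ Unit → ℝ := Sum.elim u 1 with hz
  have hcol : ∀ a : Fin d → ℝ, replicateCol Unit a *ᵥ (1 : Unit → ℝ) = a := fun a => by
    ext i
    simp [mulVec, dotProduct]
  have happ : appendCol g G *ᵥ z = G *ᵥ u + g := by
    rw [appendCol, hz, fromCols_mulVec]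
    simp [hcol]
  have hblock : z ⬝ᵥ (fromBlocks G (replicateCol Unit g) (replicateRow Unit g) 0 *ᵥ z)
      = u ⬝ᵥ (G *ᵥ u) + 2 * (g ⬝ᵥ u) := by
    rw [hz, fromBlocks_mulVec]
    simp only [Sum.elim_comp_inl, Sum.elim_comp_inr, hcol, zero_mulVec, add_zero]
    simp [dotProduct, mulVec, Fintype.sum_sum_type, mul_add, Finset.sum_add_distrib, mul_comm]
    ring
  rw [vecMulVec_mul, trace_vecMulVec, dotProduct_comm, ← dotProduct_mulVec, add_mulVec,
    dotProduct_add, hblock, ← mulVec_mulVec, ← mulVec_mulVec, happ, dotProduct_mulVec z,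
    vecMul_transpose, happ]

/-- The function `Φ` bounds the logarithm of the exponential moments over the normal laws of the
class. -/
theorem Admissible.lintegral_exp_quadratic_le (hD : D.Admissible) {g : Fin d → ℝ}
    {G Θ : Matrix (Fin d) (Fin d) ℝ} (hgG : (g, G) ∈ D.detectorSet) (hΘ : Θ ∈ D.U)
    {u : EuclideanSpace ℝ (Fin d)}
    (hu : vecMulVec (Sum.elim u (1 : Unit → ℝ)) (Sum.elim u (1 : Unit → ℝ)) ∈ D.Z) :
    ∫⁻ x, ENNReal.ofReal (Real.exp ((1 / 2) * (x.ofLp ⬝ᵥ (G *ᵥ x.ofLp)) + g ⬝ᵥ x.ofLp))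
        ∂multivariateGaussian u Θ
      ≤ ENNReal.ofReal (Real.exp (D.Φ g G Θ)) := by
  obtain ⟨hG, hlow, hup⟩ := hgG
  simp only at hG hlow hup
  have hΘpd := hD.posDef_U Θ hΘ
  have hΘs := hD.posDef_Θs hΘ
  set R := msqrt Θ with hR
  set Rs := msqrt D.Θs with hRs
  have hRR : R * R = Θ := msqrt_mul_self hΘpd.posSemidef
  have hRsRs : Rs * Rs = D.Θs := msqrt_mul_self hΘs.posSemidef
  have hRT : Rᵀ = R := transpose_msqrt _
  have hRsT : Rsᵀ = Rs := transpose_msqrt _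
  have hRu : IsUnit R.det := isUnit_det_msqrt hΘpd
  have hRsu : IsUnit Rs.det := isUnit_det_msqrt hΘs
  set Q := R * Rs⁻¹ with hQ
  set S := D.scaled G with hS
  have hSdef : S = Rs * G * Rs := rfl
  have hQT : Qᵀ = Rs⁻¹ * R := by rw [hQ, transpose_mul, transpose_nonsing_inv, hRsT, hRT]
  have hSsymm : S.IsSymm := by
    rw [IsSymm, hSdef, transpose_mul, transpose_mul, hRsT, hG.eq, mul_assoc]
  have hone : Rs * D.Θs⁻¹ * Rs = 1 := by
    rw [← hRsRs, Matrix.mul_inv_rev, ← mul_assoc, mul_nonsing_inv _ hRsu, one_mul,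
      nonsing_inv_mul _ hRsu]
  have hconj : ∀ {M : Matrix (Fin d) (Fin d) ℝ}, M.PosSemidef → (Rs * M * Rs).PosSemidef :=
    fun {M} hM => by
      have := hM.mul_mul_conjTranspose_same Rs
      rwa [conjTranspose_eq_transpose_of_trivial, hRsT] at this
  have hSβ : specNorm S ≤ D.β := by
    refine specNorm_le_of_loewnerLE hD.β_nonneg hSsymm ?_ ?_
    · have := hconj hlow
      rwa [mul_sub, sub_mul, mul_neg, neg_mul, mul_smul_comm, smul_mul_assoc, hone] at this
    · have := hconj hup
      rwa [mul_sub, sub_mul, mul_smul_comm, smul_mul_assoc, hone] at this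
  have hS1 : specNorm S < 1 := hSβ.trans_lt hD.β_lt_one
  have hQ1 : specNorm Q ≤ 1 := by
    apply specNorm_le_one_of_posSemidef
    have := (hD.le_Θs Θ hΘ).mul_mul_conjTranspose_same Rs⁻¹
    rw [conjTranspose_eq_transpose_of_trivial, transpose_nonsing_inv, hRsT, mul_sub, sub_mul] at this
    have h1 : Rs⁻¹ * D.Θs * Rs⁻¹ = 1 := by
      rw [← hRsRs, ← mul_assoc, nonsing_inv_mul _ hRsu, one_mul, mul_nonsing_inv _ hRsu]
    have h2 : Qᵀ * Q = Rs⁻¹ * Θ * Rs⁻¹ := by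
      rw [hQT, hQ, ← hRR]
      simp only [mul_assoc]
    rwa [h1, ← h2] at this
  -- The true covariance is reached from `Θs` by the contraction `Q`, so the log-determinant
  -- comparison applies.
  have hQSQ : Q * S * Qᵀ = R * G * R := by
    have h1 : Q * Rs = R := by rw [hQ, mul_assoc, nonsing_inv_mul _ hRsu, mul_one]
    have h2 : Rs * Qᵀ = R := by rw [hQT, ← mul_assoc, mul_nonsing_inv _ hRsu, one_mul]
    calc Q * S * Qᵀ = (Q * Rs) * G * (Rs * Qᵀ) := by rw [hSdef]; simp only [mul_assoc]
      _ = R * G * R := by rw [h1, h2]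
  have hdet := neg_half_log_det_conj_le hSsymm hS1 hQ1 (hD.norm_le_δ Θ hΘ)
  have htr : (Q * S * Qᵀ - S).trace = ((Θ - D.Θs) * G).trace := by
    rw [hQSQ, hSdef, trace_sub, sub_mul, trace_sub, trace_mul_comm, ← mul_assoc, hRR,
      trace_mul_comm (Rs * G), ← mul_assoc, hRsRs]
  rw [htr, hQSQ] at hdet
  -- Split as `(1 - β) Θs⁻¹ + (β Θs⁻¹ - G)`; strictness comes from `β < 1`.
  have hN : (D.Θs⁻¹ - G).PosDef := by
    have h1 : ((1 - D.β) • D.Θs⁻¹).PosDef := hΘs.inv.smul (sub_pos.2 hD.β_lt_one)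
    have := h1.add_posSemidef hup
    rwa [sub_smul, one_smul, sub_add_sub_cancel] at this
  have hNN : ((Θ⁻¹ - G) - (D.Θs⁻¹ - G)).PosSemidef := by
    rw [sub_sub_sub_cancel_right]
    exact posSemidef_inv_sub_inv hΘpd hΘs (hD.le_Θs Θ hΘ)
  have hN' : (Θ⁻¹ - G).PosDef := by
    have := hN.add_posSemidef hNN
    rwa [add_sub_cancel] at this
  have hfac : 1 - R * G * R = R * (Θ⁻¹ - G) * R := by
    rw [mul_sub, sub_mul, ← hRR, Matrix.mul_inv_rev, ← mul_assoc R, mul_nonsing_inv _ hRu, one_mul,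
      nonsing_inv_mul _ hRu]
  have hA : (1 - R * G * R).PosDef := by
    have := hN'.mul_mul_conjTranspose_same (B := R)
      (vecMul_injective_iff_isUnit.2 ((isUnit_iff_isUnit_det R).2 hRu))
    rwa [conjTranspose_eq_transpose_of_trivial, hRT, ← hfac] at this
  set p := G *ᵥ u.ofLp + g with hp
  have hpA : (R *ᵥ p) ⬝ᵥ ((1 - R * G * R)⁻¹ *ᵥ (R *ᵥ p)) = p ⬝ᵥ ((Θ⁻¹ - G)⁻¹ *ᵥ p) := by
    have h1 : R * (1 - R * G * R)⁻¹ * R = (Θ⁻¹ - G)⁻¹ := by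
      rw [hfac, Matrix.mul_inv_rev, Matrix.mul_inv_rev, ← mul_assoc, mul_nonsing_inv _ hRu, one_mul,
        mul_assoc, nonsing_inv_mul _ hRu, mul_one]
    rw [← h1, ← mulVec_mulVec, ← mulVec_mulVec, dotProduct_mulVec p, ← mulVec_transpose, hRT]
  have hpN := dotProduct_inv_mulVec_le hN hN' hNN p
  have hsup := hD.trace_le_supportFun
    (fromBlocks G (replicateCol Unit g) (replicateRow Unit g) 0
          + (appendCol g G)ᵀ * (D.Θs⁻¹ - G)⁻¹ * appendCol g G) hu
  rw [trace_vecMulVec_mul_lifted] at hsup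
  rw [lintegral_exp_quadratic_multivariateGaussian u g hG hA]
  refine ENNReal.ofReal_le_ofReal (Real.exp_le_exp.2 ?_)
  rw [Φ, hpA]
  linarith

end UncertaintyData

end GaussianBound

/-! ### Risk of the detector at the saddle point -/

section Saddle

variable {d : ℕ} {D₀ D₁ : UncertaintyData d} {h : Fin d → ℝ} {H Θ₀ Θ₁ : Matrix (Fin d) (Fin d) ℝ}

lemma bddAbove_objective (hD₀ : D₀.Admissible) (hD₁ : D₁.Admissible)
    (p : (Fin d → ℝ) × Matrix (Fin d) (Fin d) ℝ) :
    BddAbove (Set.range fun q : ↥(D₀.U ×ˢ D₁.U) => objective D₀ D₁ p q) := by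
  have hcont : Continuous (objective D₀ D₁ p) := by
    unfold objective UncertaintyData.Φ
    fun_prop
  have := ((hD₀.compact_U.prod hD₁.compact_U).image hcont).bddAbove
  rwa [Set.image_eq_range] at this

/-- For every `p`, the inner supremum is at least the value at `(Θ₀, Θ₁)`, which the saddle property
bounds below. Only this inequality is needed. -/
lemma objective_le_saddleValue (hD₀ : D₀.Admissible) (hD₁ : D₁.Admissible)
    (hs : IsSaddle D₀ D₁ h H Θ₀ Θ₁) :
    objective D₀ D₁ (h, H) (Θ₀, Θ₁) ≤ saddleValue D₀ D₁ := by
  obtain ⟨hp, hq, hsp⟩ := hs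
  have : Nonempty ↥(D₀.detectorSet ∩ D₁.detectorSet) := ⟨⟨_, hp⟩⟩
  refine le_ciInf fun p => ?_
  exact (hsp p p.2 (Θ₀, Θ₁) hq).trans
    (le_ciSup (bddAbove_objective hD₀ hD₁ p) ⟨(Θ₀, Θ₁), hq⟩)

lemma continuous_detector : Continuous (detector D₀ D₁ h H Θ₀ Θ₁) := by
  unfold detector
  simp only [dotProduct, mulVec]
  fun_prop

/-- Under every law of the first class, the detector has risk at most `ε⋆`. -/
theorem lintegral_exp_neg_detector_le (hD₀ : D₀.Admissible) (hD₁ : D₁.Admissible)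
    (hs : IsSaddle D₀ D₁ h H Θ₀ Θ₁) {ν : Measure (EuclideanSpace ℝ (Fin d))}
    (hν : ν ∈ D₀.gaussianClass) :
    ∫⁻ x, ENNReal.ofReal (Real.exp (-detector D₀ D₁ h H Θ₀ Θ₁ x)) ∂ν
      ≤ ENNReal.ofReal (epsStar D₀ D₁) := by
  obtain ⟨u, Θ, hΘ, hu, rfl⟩ := hν
  have hval := objective_le_saddleValue hD₀ hD₁ hs
  obtain ⟨hp, hq, hsp⟩ := hs
  have hmax : D₀.Φ (-h) (-H) Θ ≤ D₀.Φ (-h) (-H) Θ₀ := by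
    have := hsp (h, H) hp (Θ, Θ₁) ⟨hΘ, hq.2⟩
    simp only [objective] at this
    linarith
  set c := (1 / 2) * (D₀.Φ (-h) (-H) Θ₀ - D₁.Φ h H Θ₁) with hc
  have hpt : ∀ x : EuclideanSpace ℝ (Fin d),
      ENNReal.ofReal (Real.exp (-detector D₀ D₁ h H Θ₀ Θ₁ x))
      = ENNReal.ofReal (Real.exp (-c)) * ENNReal.ofReal (Real.exp
        ((1 / 2) * (x.ofLp ⬝ᵥ ((-H) *ᵥ x.ofLp)) + (-h) ⬝ᵥ x.ofLp)) := fun x => by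
    rw [← ENNReal.ofReal_mul (Real.exp_pos _).le, ← Real.exp_add, detector, neg_mulVec,
      dotProduct_neg, neg_dotProduct]
    congr 2
    ring
  rw [lintegral_congr hpt, lintegral_const_mul' _ _ ENNReal.ofReal_ne_top]
  refine (mul_le_mul_right (hD₀.lintegral_exp_quadratic_le
    (UncertaintyData.neg_mem_detectorSet hp.1) hΘ hu) _).trans ?_
  rw [← ENNReal.ofReal_mul (Real.exp_pos _).le, ← Real.exp_add, epsStar]
  -- By `hmax`, the exponent is at most `-c + Φ₀ = (Φ₀ + Φ₁) / 2`.
  refine ENNReal.ofReal_le_ofReal (Real.exp_le_exp.2 (le_trans ?_ hval))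
  rw [objective, hc]
  simp only
  linarith

end Saddle

end RobustCusum

theorem corollary1 {d : ℕ} (D₀ D₁ : RobustCusum.UncertaintyData d)
    (hD₀ : D₀.Admissible) (hD₁ : D₁.Admissible)
    -- a saddle point, and `ε⋆ < 1`, so that `log (ε⋆ / (1 - ε⋆))` is finite
    (h : Fin d → ℝ) (H Θ₀ Θ₁ : Matrix (Fin d) (Fin d) ℝ)
    (hsaddle : RobustCusum.IsSaddle D₀ D₁ h H Θ₀ Θ₁)
    (hε : RobustCusum.epsStar D₀ D₁ < 1)
    (γ b : ℝ) (hγ : 0 < γ)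
    (hb : Real.log γ + Real.log
      (RobustCusum.epsStar D₀ D₁ / (1 - RobustCusum.epsStar D₀ D₁)) ≤ b)
    (ν₀ : Measure (EuclideanSpace ℝ (Fin d))) (hν₀ : ν₀ ∈ D₀.gaussianClass)
    -- independent observations with the pre-change law `ν₀`
    {Ω : Type*} [MeasurableSpace Ω] (P : Measure Ω) [IsProbabilityMeasure P]
    (ξ : ℕ → Ω → EuclideanSpace ℝ (Fin d)) (hmeas : ∀ i, Measurable (ξ i))
    (hindep : iIndepFun ξ P) (hlaw : ∀ i, P.map (ξ i) = ν₀) :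
    ENNReal.ofReal γ ≤
      ∫⁻ ω, (RobustCusum.stoppingTime (RobustCusum.detector D₀ D₁ h H Θ₀ Θ₁) b
        (fun i => ξ i ω) : ℝ≥0∞) ∂P := by
  set ε := RobustCusum.epsStar D₀ D₁ with hεdef
  have hε0 : 0 < ε := Real.exp_pos _
  have hcont : Continuous (RobustCusum.detector D₀ D₁ h H Θ₀ Θ₁) :=
    RobustCusum.continuous_detector
  have hL : ∀ i, ∫⁻ ω, ENNReal.ofReal
      (Real.exp (-RobustCusum.detector D₀ D₁ h H Θ₀ Θ₁ (ξ i ω))) ∂P ≤ ENNReal.ofReal ε := by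
    intro i
    have hm : Measurable fun x => ENNReal.ofReal
        (Real.exp (-RobustCusum.detector D₀ D₁ h H Θ₀ Θ₁ x)) :=
      ENNReal.measurable_ofReal.comp (Real.measurable_exp.comp hcont.measurable.neg)
    rw [← lintegral_map hm (hmeas i), hlaw i]
    exact RobustCusum.lintegral_exp_neg_detector_le hD₀ hD₁ hsaddle hν₀
  have hmain := RobustCusum.exp_threshold_le_mul_lintegral_stoppingTime (b := b)
    hcont.measurable hmeas hindep (ENNReal.ofReal_pos.2 hε0).ne'
    (ENNReal.ofReal_le_one.2 hε.le) hL
  -- The threshold gives `exp b ≥ γ ε / (1 - ε)`, more than the `γ ε` that suffices.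
  have hγb : ε * γ ≤ Real.exp b := by
    have h1 : 0 < 1 - ε := sub_pos.2 hε
    have h2 : γ * (ε / (1 - ε)) ≤ Real.exp b := by
      rw [← Real.log_mul hγ.ne' (by positivity)] at hb
      exact (Real.log_le_iff_le_exp (by positivity)).1 hb
    have h3 : ε ≤ ε / (1 - ε) := le_div_self hε0.le h1 (by linarith)
    nlinarith
  refine (ENNReal.mul_le_mul_iff_right (ENNReal.ofReal_pos.2 hε0).ne' ENNReal.ofReal_ne_top).1
    (le_trans ?_ hmain)
  rw [← ENNReal.ofReal_mul hε0.le]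
  exact ENNReal.ofReal_le_ofReal hγb
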